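/- Let $G$ be a compact (Hausdorff) group with Haar probability measure $m_G$. A pair $(A,B)$ of Borel sets in $G$ is *critical* if $m_G(AB)=\min(1,m_G(A)+m_G(B))$ (with $m_G(AB)$ read as outer Haar measure should $AB$ fail to be Haar measurable). It is *stable* if, for all $x,y\in G$, $xB\subset AB$ implies $x\in A$, and $Ay\subset AB$ implies $y\in B$. A set is *regular* if it equals the closure of its interior. For Borel sets write $A\sim A'$ if $A$ and $A'$ differ by a Haar null set. (i) Let $(A_1,B_1)$ and $(A_2,B_2)$ be critical pairs in $G$ with $A_1\sim A_2$ and $B_1\sim B_2$. If $(A_2,B_2)$ is stable and $A_2$, $B_2$ are regular, then $A_1\subset A_2$ and $B_1\subset B_2$. (ii) Let $(A,B)$ be a critical pair in a compact group $G$ and $(I,J)$ a critical pair in a compact group $M$. Consider an open subgroup $L<G$ and $s,t\in G$ with $sA\subset L$ and $Bt\subset L$, a compact group $S$, a continuous surjective homomorphism $p:S\to L$, a compact subgroup $K$ of $\operatorname{Aut}(M)$ (the continuous automorphisms of $M$, with the compact-open topology) with $k(J)=J$ for all $k\in K$, a continuous surjective homomorphism $\pi:S\to M\rtimes K$, and $s',t'\in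 M\rtimes K$. Write $I\rtimes K=\{(m,k): m\in I\}$, and similarly for $J$. The pair $(A,B)$ *almost reduces* to $(I,J)$ if $m_G(AB)=m_M(IJ)$ and such data exist for which $p^{-1}(sA)\setminus\pi^{-1}(s'(I\rtimes K))$ and $p^{-1}(Bt)\setminus\pi^{-1}((J\rtimes K)t')$ are Haar null in $S$; it *reduces* to $(I,J)$ if $m_G(AB)=m_M(IJ)$ and such data exist for which these two differences are empty. Suppose that $(I,J)$ is stable and that $I$ and $J$ are regular. If $(A,B)$ almost reduces to $(I,J)$, then $(A,B)$ reduces to $(I,J)$. Moreover, for any data as above for which the two differences are Haar null in $S$, if $m_G(AB)=m_M(IJ)$ or $m_L(sABt)=m_M(IJ)$, that is, $m_G(AB)=m_G(L)\,m_M(IJ)$, then the two differences are empty for the same data. -/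

import Mathlib

open MeasureTheory TopologicalSpace
open scoped Pointwise ENNReal

universe u v w

/-- The Haar probability measure of a compact group. On a set that is not Haar measurable its value
is the outer Haar measure. -/
noncomputable def haarProb (G : Type u) [Group G] [TopologicalSpace G] [IsTopologicalGroup G]
    [CompactSpace G] [MeasurableSpace G] [BorelSpace G] : Measure G :=
  Measure.haarMeasure (⊤ : PositiveCompacts G)

/-- A pair of Borel sets with `m(AB) = min(1, m(A) + m(B))`. -/
structure IsCriticalPair {G : Type u} [Group G] [TopologicalSpace G] [IsTopologicalGroup G]
    [CompactSpace G] [MeasurableSpace G] [BorelSpace G] (A B : Set G) : Prop where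
  measurableSet_left : MeasurableSet A
  measurableSet_right : MeasurableSet B
  measure_mul : haarProb G (A * B) = min 1 (haarProb G A + haarProb G B)

/-- `xB ⊆ AB` implies `x ∈ A`. -/
def IsLeftStable {G : Type u} [Group G] (A B : Set G) : Prop :=
  ∀ x : G, {x} * B ⊆ A * B → x ∈ A

/-- `Ay ⊆ AB` implies `y ∈ B`. -/
def IsRightStable {G : Type u} [Group G] (A B : Set G) : Prop :=
  ∀ y : G, A * {y} ⊆ A * B → y ∈ B

def IsStablePair {G : Type u} [Group G] (A B : Set G) : Prop :=
  IsLeftStable A B ∧ IsRightStable A B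

/-- A set that equals the closure of its interior. -/
def IsRegularSet {X : Type u} [TopologicalSpace X] (A : Set X) : Prop :=
  A = closure (interior A)

/-- A group of continuous automorphisms of `M`, viewed inside `C(M, M)`. -/
def autToContinuousMap {M : Type v} [Group M] [TopologicalSpace M] (K : Subgroup (MulAut M))
    (hK : ∀ k ∈ K, Continuous (fun x : M => k x)) (k : K) : C(M, M) where
  toFun x := (k : MulAut M) x
  continuous_toFun := hK k k.2

/-- The product topology on `M ⋊ K`, where `K` carries the compact-open topology. -/
@[reducible]
def semidirectTopology {M : Type v} [Group M] [TopologicalSpace M] (K : Subgroup (MulAut M))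
    (hK : ∀ k ∈ K, Continuous (fun x : M => k x)) : TopologicalSpace (M ⋊[K.subtype] K) :=
  TopologicalSpace.induced (fun x => (x.left, autToContinuousMap K hK x.right)) inferInstance

/-- The subset `I ⋊ K` of `M ⋊ K`. -/
def semidirectSet {M : Type v} [Group M] (I : Set M) (K : Subgroup (MulAut M)) :
    Set (M ⋊[K.subtype] K) :=
  {x | x.left ∈ I}

/-- The groups, homomorphisms and translations that occur in a reduction of a pair in `G` to a pair
in `M`: an open subgroup `L` of `G`, elements `s, t` of `G`, a compact group `S` with a continuous
surjective homomorphism `p : S → L`, a compact group `K` of continuous automorphisms of `M`, a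
continuous surjective homomorphism `π : S → M ⋊ K`, and elements `s', t'` of `M ⋊ K`. -/
structure ReductionData (G : Type u) (M : Type v) [Group G] [TopologicalSpace G] [Group M]
    [TopologicalSpace M] where
  L : Subgroup G
  isOpen_L : IsOpen (L : Set G)
  s : G
  t : G
  S : Type w
  [groupS : Group S]
  [topologicalSpaceS : TopologicalSpace S]
  [isTopologicalGroupS : IsTopologicalGroup S]
  [compactSpaceS : CompactSpace S]
  [t2SpaceS : T2Space S]
  [measurableSpaceS : MeasurableSpace S]
  [borelSpaceS : BorelSpace S]
  p : S →* L
  continuous_p : Continuous p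
  surjective_p : Function.Surjective p
  K : Subgroup (MulAut M)
  continuous_K : ∀ k ∈ K, Continuous (fun x : M => k x)
  isCompact_K : IsCompact (Set.range (autToContinuousMap K continuous_K))
  π : S →* M ⋊[K.subtype] K
  continuous_π : @Continuous S (M ⋊[K.subtype] K) _ (semidirectTopology K continuous_K) π
  surjective_π : Function.Surjective π
  s' : M ⋊[K.subtype] K
  t' : M ⋊[K.subtype] K

attribute [instance] ReductionData.groupS ReductionData.topologicalSpaceS
  ReductionData.isTopologicalGroupS ReductionData.compactSpaceS ReductionData.t2SpaceS
  ReductionData.measurableSpaceS ReductionData.borelSpaceS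

namespace ReductionData

variable {G : Type u} {M : Type v} [Group G] [TopologicalSpace G] [Group M] [TopologicalSpace M]

/-- `p⁻¹(sA)`, a subset of `S`. -/
def leftSource (D : ReductionData.{u, v, w} G M) (A : Set G) : Set D.S :=
  {x | (D.p x : G) ∈ {D.s} * A}

/-- `p⁻¹(Bt)`, a subset of `S`. -/
def rightSource (D : ReductionData.{u, v, w} G M) (B : Set G) : Set D.S :=
  {x | (D.p x : G) ∈ B * {D.t}}

/-- `π⁻¹(s'(I ⋊ K))`, a subset of `S`. -/
def leftTarget (D : ReductionData.{u, v, w} G M) (I : Set M) : Set D.S :=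
  D.π ⁻¹' ({D.s'} * semidirectSet I D.K)

/-- `π⁻¹((J ⋊ K)t')`, a subset of `S`. -/
def rightTarget (D : ReductionData.{u, v, w} G M) (J : Set M) : Set D.S :=
  D.π ⁻¹' (semidirectSet J D.K * {D.t'})

/-- The conditions on the data that an almost reduction and a reduction share: `sA ⊆ L`, `Bt ⊆ L`,
and `K` fixes the set `J`. -/
structure IsAdapted (D : ReductionData.{u, v, w} G M) (A B : Set G) (J : Set M) : Prop where
  left_subset : {D.s} * A ⊆ (D.L : Set G)
  right_subset : B * {D.t} ⊆ (D.L : Set G)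
  fixes : ∀ k ∈ D.K, (fun x : M => k x) '' J = J

/-- The containments of an almost reduction, up to Haar null sets of `S`. -/
def AlmostContains (D : ReductionData.{u, v, w} G M) (A B : Set G) (I J : Set M) : Prop :=
  haarProb D.S (D.leftSource A \ D.leftTarget I) = 0 ∧
    haarProb D.S (D.rightSource B \ D.rightTarget J) = 0

/-- The containments of a reduction. -/
def Contains (D : ReductionData.{u, v, w} G M) (A B : Set G) (I J : Set M) : Prop :=
  D.leftSource A ⊆ D.leftTarget I ∧ D.rightSource B ⊆ D.rightTarget J

end ReductionData

/-- The pair `(A, B)` in `G` almost reduces to the pair `(I, J)` in `M`. -/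
def AlmostReduces {G : Type u} {M : Type v}
    [Group G] [TopologicalSpace G] [IsTopologicalGroup G] [CompactSpace G]
    [MeasurableSpace G] [BorelSpace G]
    [Group M] [TopologicalSpace M] [IsTopologicalGroup M] [CompactSpace M]
    [MeasurableSpace M] [BorelSpace M]
    (A B : Set G) (I J : Set M) : Prop :=
  haarProb G (A * B) = haarProb M (I * J) ∧
    ∃ D : ReductionData.{u, v, w} G M, D.IsAdapted A B J ∧ D.AlmostContains A B I J

/-- The pair `(A, B)` in `G` reduces to the pair `(I, J)` in `M`. -/
def Reduces {G : Type u} {M : Type v}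
    [Group G] [TopologicalSpace G] [IsTopologicalGroup G] [CompactSpace G]
    [MeasurableSpace G] [BorelSpace G]
    [Group M] [TopologicalSpace M] [IsTopologicalGroup M] [CompactSpace M]
    [MeasurableSpace M] [BorelSpace M]
    (A B : Set G) (I J : Set M) : Prop :=
  haarProb G (A * B) = haarProb M (I * J) ∧
    ∃ D : ReductionData.{u, v, w} G M, D.IsAdapted A B J ∧ D.Contains A B I J

open Filter Topology Set


/-! For (i), it suffices that `A₁ * B₁ \ A₂ * B₂` is null. Suppose `a ∈ A₁`, `b ∈ B₂` and `a * b`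
lies outside the closed set `A₂ * B₂`. Since `B₂` is regular, this holds for a set of such `b` of
positive measure, almost all of them in `B₁`, so the difference is not null. Otherwise `{a} * B₂ ⊆
A₂ * B₂` and stability gives `a ∈ A₂` (`IsStablePair.subset_of_measure_diff_eq_zero`).

Both product sets contain `(A₁ ∩ A₂) * (B₁ ∩ B₂)`, so one needs that removing null sets from `A₂`
and `B₂` does not lower the measure of the product (`measure_mul_le_of_isRegularSet`). This rests on
Kemperman's theorem: if `X * Y ⊆ Q` and `m(Q) < m(X) + m(Y)`, then around each `x * y` the set `Q`
contains `x * H * y` with `H` an open subgroup. Applied to the reduced sets with one point adjoined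
to each, it covers the full product locally up to null sets, and compactness concludes. Kemperman's
theorem follows from the `e`-transform of an extremal pair, which exists by a lattice argument.

For (ii), the `M`-coordinate `leftCoord : S → M` is open and measure preserving, and since `K` fixes
`J` it pulls the product and the stability of `(I, J)` back to `S`. The measure identities turn
containment up to null sets into equality up to null sets, and the argument of (i) applies in `S`.
-/

/-! ### Maxima of supermodular functions -/

/-- A supermodular function on a sublattice that is closed under monotone limits, along which the
function is continuous, attains its maximum. -/
theorem exists_forall_le_of_supermodular {α : Type*} [CompleteLattice α] {P : Set α}
    (hne : P.Nonempty) {ψ : α → ℝ} (hbdd : BddAbove (ψ '' P))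
    (hsup : ∀ a ∈ P, ∀ b ∈ P, a ⊔ b ∈ P) (hinf : ∀ a ∈ P, ∀ b ∈ P, a ⊓ b ∈ P)
    (hmod : ∀ a ∈ P, ∀ b ∈ P, ψ a + ψ b ≤ ψ (a ⊔ b) + ψ (a ⊓ b))
    (hmono : ∀ f : ℕ → α, Monotone f → (∀ n, f n ∈ P) →
      (⨆ n, f n) ∈ P ∧ Tendsto (fun n => ψ (f n)) atTop (𝓝 (ψ (⨆ n, f n))))
    (hanti : ∀ f : ℕ → α, Antitone f → (∀ n, f n ∈ P) →
      (⨅ n, f n) ∈ P ∧ Tendsto (fun n => ψ (f n)) atTop (𝓝 (ψ (⨅ n, f n)))) :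
    ∃ a ∈ P, ∀ b ∈ P, ψ b ≤ ψ a := by
  set σ := sSup (ψ '' P)
  have hσ : ∀ b ∈ P, ψ b ≤ σ := fun b hb => le_csSup hbdd (mem_image_of_mem _ hb)
  have hex : ∀ n : ℕ, ∃ a ∈ P, σ - (1 / 2) ^ n < ψ a := by
    intro n
    have h : σ - (1 / 2) ^ n < σ := by
      have : (0 : ℝ) < (1 / 2) ^ n := by positivity
      linarith
    obtain ⟨_, ⟨a, ha, rfl⟩, hlt⟩ := exists_lt_of_lt_csSup (hne.image ψ) h
    exact ⟨a, ha, hlt⟩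
  choose p hp hlt using hex
  -- As `ψ (a ⊓ b) ≤ σ`, the deficit from `σ` is subadditive under `⊔`. The bound is the sum of `(1
  -- / 2) ^ j` over `n ≤ j ≤ n + k`.
  have hpart : ∀ n k, partialSups (fun j => p (n + j)) k ∈ P ∧
      σ - 2 * (1 / 2) ^ n + (1 / 2) ^ (n + k) ≤ ψ (partialSups (fun j => p (n + j)) k) := by
    intro n k
    induction k with
    | zero =>
      simp only [partialSups_zero, add_zero]
      exact ⟨hp n, by linarith [hlt n]⟩
    | succ k ih =>
      rw [partialSups_add_one]
      have h1 := hmod _ ih.1 _ (hp (n + (k + 1)))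
      have h2 := hσ _ (hinf _ ih.1 _ (hp (n + (k + 1))))
      have h3 := hlt (n + (k + 1))
      refine ⟨hsup _ ih.1 _ (hp _), ?_⟩
      have h4 : ((1 : ℝ) / 2) ^ (n + k) = 2 * (1 / 2) ^ (n + (k + 1)) := by
        rw [← add_assoc, pow_succ]; ring
      linarith [ih.2]
  -- The maximum is attained at the limit superior `⨅ n, t n` of the sequence `p`.
  set t : ℕ → α := fun n => ⨆ j, p (n + j)
  have ht : ∀ n, t n ∈ P ∧ σ - 2 * (1 / 2) ^ n ≤ ψ (t n) := by
    intro n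
    have h := hmono (partialSups fun j => p (n + j)) (partialSups _).monotone
      fun k => (hpart n k).1
    rw [iSup_partialSups_eq] at h
    refine ⟨h.1, ge_of_tendsto' h.2 fun k => ?_⟩
    have : (0 : ℝ) < (1 / 2) ^ (n + k) := by positivity
    linarith [(hpart n k).2]
  have htanti : Antitone t := antitone_nat_of_succ_le fun n => iSup_le fun j => by
    have := le_iSup (fun j => p (n + j)) (1 + j)
    rwa [← add_assoc] at this
  have h := hanti t htanti fun n => (ht n).1
  refine ⟨_, h.1, fun b hb => (hσ b hb).trans ?_⟩
  have hlim : Tendsto (fun n : ℕ => σ - 2 * (1 / 2 : ℝ) ^ n) atTop (𝓝 (σ - 2 * 0)) :=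
    (((tendsto_pow_atTop_nhds_zero_of_lt_one (by norm_num) (by norm_num)).const_mul 2).const_sub σ)
  simpa using le_of_tendsto_of_tendsto' hlim h.2 fun n => (ht n).2

/-! ### Uniqueness and invariance of the Haar probability measure -/

section HaarProb

variable {G : Type u} [Group G] [TopologicalSpace G] [IsTopologicalGroup G] [CompactSpace G]
  [MeasurableSpace G] [BorelSpace G]

instance : (haarProb G).IsHaarMeasure := by unfold haarProb; infer_instance

instance : IsProbabilityMeasure (haarProb G) :=
  ⟨by simpa [haarProb] using Measure.haarMeasure_self (K₀ := (⊤ : PositiveCompacts G))⟩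

theorem eq_measure_univ_mul_haarProb (μ : Measure G) [IsFiniteMeasure μ] [μ.IsMulLeftInvariant]
    (s : Set G) : μ s = μ univ * haarProb G s := by
  have h := Measure.isMulInvariant_eq_smul_of_compactSpace μ (haarProb G)
  have h' : ∀ s, μ s = Measure.haarScalarFactor μ (haarProb G) * haarProb G s := fun s =>
    (congrArg (fun ν : Measure G => ν s) h).trans <| by
      rw [Measure.smul_apply, ENNReal.smul_def, smul_eq_mul]
  rw [h' univ, measure_univ, mul_one, ← h']

theorem eq_haarProb (μ : Measure G) [IsProbabilityMeasure μ] [μ.IsMulLeftInvariant] :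
    μ = haarProb G := by
  ext s -
  rw [eq_measure_univ_mul_haarProb μ s, measure_univ, one_mul]

instance : (haarProb G).IsMulRightInvariant := by
  refine ⟨fun g => ?_⟩
  have : IsProbabilityMeasure (Measure.map (· * g) (haarProb G)) :=
    Measure.isProbabilityMeasure_map (by fun_prop)
  exact eq_haarProb _

instance : (haarProb G).IsInvInvariant := by
  refine ⟨?_⟩
  have : IsProbabilityMeasure (haarProb G).inv :=
    Measure.isProbabilityMeasure_map (by fun_prop)
  exact eq_haarProb _

end HaarProb


/-! ### The lattice of pairs with product in a fixed set -/

theorem fst_iSup_pairs {X : Type*} (f : ℕ → Set X × (Set X)ᵒᵈ) : (⨆ n, f n).1 = ⋃ n, (f n).1 :=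
  Prod.fst_iSup f

theorem snd_iSup_pairs {X : Type*} (f : ℕ → Set X × (Set X)ᵒᵈ) :
    OrderDual.ofDual (⨆ n, f n).2 = ⋂ n, OrderDual.ofDual (f n).2 := by
  rw [Prod.snd_iSup, ofDual_iSup]; rfl

theorem fst_iInf_pairs {X : Type*} (f : ℕ → Set X × (Set X)ᵒᵈ) : (⨅ n, f n).1 = ⋂ n, (f n).1 :=
  Prod.fst_iInf f

theorem snd_iInf_pairs {X : Type*} (f : ℕ → Set X × (Set X)ᵒᵈ) :
    OrderDual.ofDual (⨅ n, f n).2 = ⋃ n, OrderDual.ofDual (f n).2 := by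
  rw [Prod.snd_iInf, ofDual_iInf]; rfl

theorem tendsto_measureReal_iUnion {X : Type*} [MeasurableSpace X] {μ : Measure X}
    [IsFiniteMeasure μ] {s : ℕ → Set X} (hs : Monotone s) :
    Tendsto (fun n => μ.real (s n)) atTop (𝓝 (μ.real (⋃ n, s n))) :=
  (ENNReal.tendsto_toReal (measure_ne_top μ _)).comp (tendsto_measure_iUnion_atTop hs)

theorem tendsto_measureReal_iInter {X : Type*} [MeasurableSpace X] {μ : Measure X}
    [IsFiniteMeasure μ] {s : ℕ → Set X} (hs : Antitone s)
    (hm : ∀ n, MeasurableSet (s n)) :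
    Tendsto (fun n => μ.real (s n)) atTop (𝓝 (μ.real (⋂ n, s n))) :=
  (ENNReal.tendsto_toReal (measure_ne_top μ _)).comp
    (tendsto_measure_iInter_atTop (fun n => (hm n).nullMeasurableSet) hs ⟨0, measure_ne_top μ _⟩)

section ProductPairs

variable {G : Type u} [Group G] [MeasurableSpace G]

/-- Pairs of measurable sets that contain `1` and whose product lies in `Q`; the order is that of
inclusion in the first set and of reverse inclusion in the second. -/
def productPairs (Q : Set G) : Set (Set G × (Set G)ᵒᵈ) :=
  {p | MeasurableSet p.1 ∧ MeasurableSet (OrderDual.ofDual p.2) ∧ (1 : G) ∈ p.1 ∧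
    (1 : G) ∈ OrderDual.ofDual p.2 ∧ ∀ x ∈ p.1, ∀ y ∈ OrderDual.ofDual p.2, x * y ∈ Q}

variable {Q : Set G} {p q : Set G × (Set G)ᵒᵈ}

/-- A point of the union lies in one of the first sets, and a point of the intersection lies in the
matching second set. -/
theorem sup_mem_productPairs (hp : p ∈ productPairs Q) (hq : q ∈ productPairs Q) :
    p ⊔ q ∈ productPairs Q := by
  refine ⟨hp.1.union hq.1, hp.2.1.inter hq.2.1, Or.inl hp.2.2.1, ⟨hp.2.2.2.1, hq.2.2.2.1⟩, ?_⟩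
  rintro x (hx | hx) y ⟨hy, hy'⟩
  · exact hp.2.2.2.2 x hx y hy
  · exact hq.2.2.2.2 x hx y hy'

theorem inf_mem_productPairs (hp : p ∈ productPairs Q) (hq : q ∈ productPairs Q) :
    p ⊓ q ∈ productPairs Q := by
  refine ⟨hp.1.inter hq.1, hp.2.1.union hq.2.1, ⟨hp.2.2.1, hq.2.2.1⟩, Or.inl hp.2.2.2.1, ?_⟩
  rintro x ⟨hx, hx'⟩ y (hy | hy)
  · exact hp.2.2.2.2 x hx y hy
  · exact hq.2.2.2.2 x hx' y hy

theorem iSup_mem_productPairs {f : ℕ → Set G × (Set G)ᵒᵈ} (hf : ∀ n, f n ∈ productPairs Q) :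
    (⨆ n, f n) ∈ productPairs Q := by
  simp only [productPairs, mem_ofPred_eq, fst_iSup_pairs, snd_iSup_pairs]
  refine ⟨.iUnion fun n => (hf n).1, .iInter fun n => (hf n).2.1,
    mem_iUnion.2 ⟨0, (hf 0).2.2.1⟩, mem_iInter.2 fun n => (hf n).2.2.2.1, fun x hx y hy => ?_⟩
  obtain ⟨n, hn⟩ := mem_iUnion.1 hx
  exact (hf n).2.2.2.2 x hn y (mem_iInter.1 hy n)

theorem iInf_mem_productPairs {f : ℕ → Set G × (Set G)ᵒᵈ} (hf : ∀ n, f n ∈ productPairs Q) :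
    (⨅ n, f n) ∈ productPairs Q := by
  simp only [productPairs, mem_ofPred_eq, fst_iInf_pairs, snd_iInf_pairs]
  refine ⟨.iInter fun n => (hf n).1, .iUnion fun n => (hf n).2.1,
    mem_iInter.2 fun n => (hf n).2.2.1, mem_iUnion.2 ⟨0, (hf 0).2.2.2.1⟩, fun x hx y hy => ?_⟩
  obtain ⟨n, hn⟩ := mem_iUnion.1 hy
  exact (hf n).2.2.2.2 x (mem_iInter.1 hx n) y hn

variable {μ : Measure G} [IsFiniteMeasure μ]

theorem tendsto_measureReal_of_monotone {f : ℕ → Set G × (Set G)ᵒᵈ} (hf : Monotone f)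
    (hP : ∀ n, f n ∈ productPairs Q) :
    Tendsto (fun n => μ.real (f n).1) atTop (𝓝 (μ.real (⨆ n, f n).1)) ∧
      Tendsto (fun n => μ.real (OrderDual.ofDual (f n).2)) atTop
        (𝓝 (μ.real (OrderDual.ofDual (⨆ n, f n).2))) := by
  rw [fst_iSup_pairs, snd_iSup_pairs]
  exact ⟨tendsto_measureReal_iUnion fun i j h => (hf h).1,
    tendsto_measureReal_iInter (fun i j h => (hf h).2) fun n => (hP n).2.1⟩

theorem tendsto_measureReal_of_antitone {f : ℕ → Set G × (Set G)ᵒᵈ} (hf : Antitone f)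
    (hP : ∀ n, f n ∈ productPairs Q) :
    Tendsto (fun n => μ.real (f n).1) atTop (𝓝 (μ.real (⨅ n, f n).1)) ∧
      Tendsto (fun n => μ.real (OrderDual.ofDual (f n).2)) atTop
        (𝓝 (μ.real (OrderDual.ofDual (⨅ n, f n).2))) := by
  rw [fst_iInf_pairs, snd_iInf_pairs]
  exact ⟨tendsto_measureReal_iInter (fun i j h => (hf h).1) fun n => (hP n).1,
    tendsto_measureReal_iUnion fun i j h => (hf h).2⟩

/-- Among the pairs with product in `Q` whose total measure is largest there is one whose second
set has largest measure. -/
theorem exists_maximal_productPair (hne : (productPairs Q).Nonempty) (μ : Measure G)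
    [IsFiniteMeasure μ] :
    ∃ p ∈ productPairs Q, (∀ q ∈ productPairs Q, μ.real q.1 + μ.real (OrderDual.ofDual q.2) ≤
        μ.real p.1 + μ.real (OrderDual.ofDual p.2)) ∧
      ∀ q ∈ productPairs Q, μ.real q.1 + μ.real (OrderDual.ofDual q.2) =
        μ.real p.1 + μ.real (OrderDual.ofDual p.2) →
        μ.real (OrderDual.ofDual q.2) ≤ μ.real (OrderDual.ofDual p.2) := by
  set φ : Set G × (Set G)ᵒᵈ → ℝ := fun p => μ.real p.1 + μ.real (OrderDual.ofDual p.2) with hφ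
  have hmod1 : ∀ a ∈ productPairs Q, ∀ b ∈ productPairs Q,
      μ.real (a ⊔ b).1 + μ.real (a ⊓ b).1 = μ.real a.1 + μ.real b.1 := fun a _ b hb =>
    measureReal_union_add_inter hb.1
  have hmod2 : ∀ a ∈ productPairs Q, ∀ b ∈ productPairs Q,
      μ.real (OrderDual.ofDual (a ⊔ b).2) + μ.real (OrderDual.ofDual (a ⊓ b).2) =
        μ.real (OrderDual.ofDual a.2) + μ.real (OrderDual.ofDual b.2) := fun a _ b hb =>
    (add_comm _ _).trans (measureReal_union_add_inter hb.2.1)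
  have hbound : ∀ s : Set G, μ.real s ≤ μ.real univ := fun s => measureReal_mono (subset_univ s)
  obtain ⟨p₀, hp₀, hmax⟩ := exists_forall_le_of_supermodular (ψ := φ) hne
    ⟨μ.real univ + μ.real univ, by
      rintro _ ⟨p, -, rfl⟩
      exact add_le_add (hbound _) (hbound _)⟩
    (fun a ha b hb => sup_mem_productPairs ha hb) (fun a ha b hb => inf_mem_productPairs ha hb)
    (fun a ha b hb => by
      have h1 := hmod1 a ha b hb
      have h2 := hmod2 a ha b hb
      simp only [hφ]; linarith)
    (fun f hf hP => ⟨iSup_mem_productPairs hP,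
      (tendsto_measureReal_of_monotone hf hP).1.add (tendsto_measureReal_of_monotone hf hP).2⟩)
    (fun f hf hP => ⟨iInf_mem_productPairs hP,
      (tendsto_measureReal_of_antitone hf hP).1.add (tendsto_measureReal_of_antitone hf hP).2⟩)
  -- The total `φ` is modular, so its maximizers form a sublattice, on which the second set can be
  -- maximized in turn.
  have hlat : ∀ a ∈ productPairs Q, ∀ b ∈ productPairs Q, φ a = φ p₀ → φ b = φ p₀ →
      φ (a ⊔ b) = φ p₀ ∧ φ (a ⊓ b) = φ p₀ := by
    intro a ha b hb h1 h2
    have h3 := hmod1 a ha b hb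
    have h4 := hmod2 a ha b hb
    have h5 := hmax _ (sup_mem_productPairs ha hb)
    have h6 := hmax _ (inf_mem_productPairs ha hb)
    simp only [hφ] at *
    constructor <;> linarith
  obtain ⟨p, hp, hmax'⟩ := exists_forall_le_of_supermodular
    (P := {p | p ∈ productPairs Q ∧ φ p = φ p₀}) (ψ := fun p => μ.real (OrderDual.ofDual p.2))
    ⟨p₀, hp₀, rfl⟩
    ⟨μ.real univ, by
      rintro _ ⟨p, -, rfl⟩
      exact hbound _⟩
    (fun a ha b hb => ⟨sup_mem_productPairs ha.1 hb.1, (hlat a ha.1 b hb.1 ha.2 hb.2).1⟩)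
    (fun a ha b hb => ⟨inf_mem_productPairs ha.1 hb.1, (hlat a ha.1 b hb.1 ha.2 hb.2).2⟩)
    (fun a ha b hb => (hmod2 a ha.1 b hb.1).ge)
    (fun f hf hP => by
      have h := tendsto_measureReal_of_monotone (μ := μ) hf fun n => (hP n).1
      refine ⟨⟨iSup_mem_productPairs fun n => (hP n).1, ?_⟩, h.2⟩
      refine tendsto_nhds_unique (h.1.add h.2) ?_
      exact tendsto_const_nhds.congr fun n => (hP n).2.symm)
    (fun f hf hP => by
      have h := tendsto_measureReal_of_antitone (μ := μ) hf fun n => (hP n).1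
      refine ⟨⟨iInf_mem_productPairs fun n => (hP n).1, ?_⟩, h.2⟩
      refine tendsto_nhds_unique (h.1.add h.2) ?_
      exact tendsto_const_nhds.congr fun n => (hP n).2.symm)
  exact ⟨p, hp.1, fun q hq => (hmax q hq).trans hp.2.ge,
    fun q hq h => hmax' q ⟨hq, h.trans hp.2⟩⟩

end ProductPairs

/-! ### Kemperman's theorem -/

section Kemperman

variable {G : Type u} [Group G] [TopologicalSpace G] [IsTopologicalGroup G] [CompactSpace G]
  [MeasurableSpace G] [BorelSpace G]

/-- A set that is invariant up to null sets under an open subgroup, and that meets the subgroup in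
positive measure, contains almost all of it. -/
theorem measure_subgroup_diff_eq_zero {H : Subgroup G} (hH : IsOpen (H : Set G)) {B : Set G}
    (hB : MeasurableSet B) (hHB : H ≤ MulAction.aestabilizer G (haarProb G) B)
    (hpos : haarProb G ((H : Set G) ∩ B) ≠ 0) : haarProb G ((H : Set G) \ B) = 0 := by
  have hcl : IsClosed (H : Set G) := H.isClosed_of_isOpen hH
  have : CompactSpace H := isCompact_iff_compactSpace.1 hcl.isCompact
  have hemb : IsOpenEmbedding H.subtype := hH.isOpenEmbedding_subtypeVal
  have hme : MeasurableEmbedding H.subtype := hemb.measurableEmbedding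
  set m : Measure H := (haarProb G).comap H.subtype with hm
  have : m.IsHaarMeasure :=
    @Measure.IsHaarMeasure.comap _ _ _ _ _ _ _ _ _ _ _ inferInstance (haarProb G) _ H.subtype hemb
  have hmap : m.map H.subtype = (haarProb G).restrict H := by
    rw [hm, hme.map_comap]; simp
  set C : Set H := H.subtype ⁻¹' B with hC
  have hCm : MeasurableSet C := hme.measurable hB
  have hinv : ∀ h : H, (h * ·) ⁻¹' C =ᵐ[m] C := by
    intro h
    have h1 : ((h : G)⁻¹ • B : Set G) =ᵐ[haarProb G] B := hHB (H.inv_mem h.2)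
    rw [← preimage_smul] at h1
    have h2 : ∀ᵐ x ∂(m.map H.subtype), ((h : G) * x ∈ B) = (x ∈ B) := by
      rw [hmap]
      exact ae_restrict_of_ae h1
    exact (hme.ae_map_iff).1 h2
  -- By uniqueness the invariant measure `m.restrict C` is a multiple of `m`. It vanishes on `Cᶜ`,
  -- so either `Cᶜ` is null or the factor is zero, and then `C` is null.
  have : (m.restrict C).IsMulLeftInvariant := by
    refine ⟨fun h => ?_⟩
    ext X hX
    have hmul : Measurable (h * · : H → H) := measurable_const_mul h
    rw [Measure.map_apply hmul hX, Measure.restrict_apply (hmul hX), Measure.restrict_apply hX,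
      ← measure_preimage_mul m h (X ∩ C), preimage_inter]
    exact measure_congr ((ae_eq_refl _).inter (hinv h).symm)
  have huniq := Measure.isMulInvariant_eq_smul_of_compactSpace (m.restrict C) m
  have hval : ∀ X : Set H, m X = haarProb G (H.subtype '' X) := fun X => hme.comap_apply _ X
  have h0 : m.restrict C Cᶜ = 0 := by
    rw [Measure.restrict_apply hCm.compl, compl_inter_self, measure_empty]
  rw [huniq, Measure.smul_apply] at h0
  have himg : H.subtype '' Cᶜ = (H : Set G) \ B := by
    ext x; simp [hC, and_comm]
  rw [← himg, ← hval]
  by_contra hne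
  have hc : (m.restrict C).haarScalarFactor m = 0 := by
    simpa [ENNReal.smul_def, hne] using h0
  rw [hc, zero_smul, Measure.restrict_eq_zero, hval] at huniq
  apply hpos
  rw [← huniq]
  congr 1
  ext x; simp [hC, and_comm]

/-- If `1 ∈ A ∩ B` and `AB` lies in a set `Q` of measure less than `m(A) + m(B)`, then there is such
a pair for which `A ∩ B` has positive measure and stabilizes `B` up to null sets. -/
theorem exists_pair_inter_subset_aestabilizer {A B Q : Set G} (hA : MeasurableSet A)
    (hB : MeasurableSet B) (h1A : (1 : G) ∈ A) (h1B : (1 : G) ∈ B)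
    (hQ : ∀ x ∈ A, ∀ y ∈ B, x * y ∈ Q) (hlt : haarProb G Q < haarProb G A + haarProb G B) :
    ∃ X Y : Set G, MeasurableSet X ∧ MeasurableSet Y ∧ (∀ x ∈ X, ∀ y ∈ Y, x * y ∈ Q) ∧
      X ∩ Y ⊆ MulAction.aestabilizer G (haarProb G) Y ∧ haarProb G (X ∩ Y) ≠ 0 := by
  set μ := haarProb G
  have hAB : (A, OrderDual.toDual B) ∈ productPairs Q := ⟨hA, hB, h1A, h1B, hQ⟩
  obtain ⟨⟨X, Y⟩, ⟨hX, hY, h1X, h1Y, hXY⟩, hmax, hmax'⟩ := exists_maximal_productPair ⟨_, hAB⟩ μ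
  change Set G at Y
  change MeasurableSet X at hX
  change MeasurableSet Y at hY
  change (1 : G) ∈ X at h1X
  change (1 : G) ∈ Y at h1Y
  change ∀ x ∈ X, ∀ y ∈ Y, x * y ∈ Q at hXY
  refine ⟨X, Y, hX, hY, hXY, ?_, ?_⟩
  · rintro e ⟨heX, heY⟩
    -- The `e`-transform: here `X' = Xe⁻¹`, `X'' = Xe`, `Y' = e⁻¹Y`, `Y'' = eY`. Membership of `e`
    -- in both `X` and `Y` keeps `1` in the intersections.
    set X' : Set G := (· * e) ⁻¹' X
    set X'' : Set G := (· * e⁻¹) ⁻¹' X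
    set Y' : Set G := (e * ·) ⁻¹' Y
    set Y'' : Set G := (e⁻¹ * ·) ⁻¹' Y
    have hX' : MeasurableSet X' := measurable_mul_const e hX
    have hX'' : MeasurableSet X'' := measurable_mul_const e⁻¹ hX
    have hY' : MeasurableSet Y' := measurable_const_mul e hY
    have hY'' : MeasurableSet Y'' := measurable_const_mul e⁻¹ hY
    have hP1 : (X ∪ X'', OrderDual.toDual (Y ∩ Y')) ∈ productPairs Q := by
      refine ⟨hX.union hX'', hY.inter hY', Or.inl h1X, ⟨h1Y, ?_⟩, ?_⟩
      · change e * 1 ∈ Y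
        rwa [mul_one]
      · rintro x (hx | hx) y ⟨hy, hy'⟩
        · exact hXY x hx y hy
        · have := hXY _ hx _ hy'
          rwa [mul_assoc, inv_mul_cancel_left] at this
    have hP2 : (X ∩ X', OrderDual.toDual (Y ∪ Y'')) ∈ productPairs Q := by
      refine ⟨hX.inter hX', hY.union hY'', ⟨h1X, ?_⟩, Or.inl h1Y, ?_⟩
      · change 1 * e ∈ X
        rwa [one_mul]
      · rintro x ⟨hx, hx'⟩ y (hy | hy)
        · exact hXY x hx y hy
        · have := hXY _ hx' _ hy
          rwa [mul_assoc, mul_inv_cancel_left] at this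
    have hreal : ∀ {s t : Set G}, μ s = μ t → μ.real s = μ.real t := fun h => by
      simp only [measureReal_def, h]
    have e1 : μ.real (X ∪ X'') + μ.real (X ∩ X'') = μ.real X + μ.real X'' :=
      measureReal_union_add_inter hX''
    have e2 : μ.real X'' = μ.real X := hreal (measure_preimage_mul_right μ e⁻¹ X)
    have e3 : μ.real (X ∩ X'') = μ.real (X ∩ X') := by
      rw [← hreal (measure_preimage_mul_right μ e (X ∩ X'')), preimage_inter, inter_comm]
      congr 1
      ext x; simp [X', X'']
    have e4 : μ.real (Y ∪ Y'') + μ.real (Y ∩ Y'') = μ.real Y + μ.real Y'' :=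
      measureReal_union_add_inter hY''
    have e5 : μ.real Y'' = μ.real Y := hreal (measure_preimage_mul μ e⁻¹ Y)
    have e6 : μ.real (Y ∩ Y'') = μ.real (Y ∩ Y') := by
      rw [← hreal (measure_preimage_mul μ e (Y ∩ Y'')), preimage_inter, inter_comm]
      congr 1
      ext x; simp [Y', Y'']
    -- The totals of the two transformed pairs add up to twice the maximum, so each attains it. The
    -- second maximality then gives `m(Y ∪ eY) ≤ m(Y)`.
    have m1 := hmax _ hP1
    have m2 := hmax _ hP2
    have m3 := hmax' _ hP2
    simp only [OrderDual.ofDual_toDual] at m1 m2 m3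
    change _ ≤ μ.real X + μ.real Y at m1
    change _ ≤ μ.real X + μ.real Y at m2
    change _ = μ.real X + μ.real Y → _ ≤ μ.real Y at m3
    have m4 := m3 (by linarith)
    have hle : μ (Y ∪ Y'') ≤ μ Y :=
      (ENNReal.toReal_le_toReal (measure_ne_top μ _) (measure_ne_top μ _)).1 m4
    have hae : (Y : Set G) =ᵐ[μ] (Y ∪ Y'' : Set G) :=
      ae_eq_of_subset_of_measure_ge subset_union_left hle hY.nullMeasurableSet (measure_ne_top μ _)
    have hae' : (Y'' : Set G) =ᵐ[μ] (Y ∪ Y'' : Set G) :=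
      ae_eq_of_subset_of_measure_ge subset_union_right
        (hle.trans (measure_preimage_mul μ e⁻¹ Y).ge) hY''.nullMeasurableSet (measure_ne_top μ _)
    have heq : Y'' = e • Y := by
      ext x; simp [Y'', mem_smul_set_iff_inv_smul_mem]
    change e • Y =ᵐ[μ] Y
    rw [← heq]
    exact hae'.trans hae.symm
  -- Since `1` lies in both sets, `X ∪ Y ⊆ Q`; were the intersection null, `Q` would have measure at
  -- least `m(X) + m(Y)`.
  · intro h0
    have h1 : μ (X ∪ Y) + μ (X ∩ Y) = μ X + μ Y := measure_union_add_inter X hY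
    have h2 : X ∪ Y ⊆ Q := by
      rintro x (hx | hx)
      · simpa using hXY x hx 1 h1Y
      · simpa using hXY 1 h1X x hx
    have h3 := hmax _ hAB
    simp only [OrderDual.ofDual_toDual] at h3
    change _ ≤ μ.real X + μ.real Y at h3
    have h4 : μ A + μ B ≤ μ X + μ Y := by
      have hfin : ∀ s, μ s ≠ ∞ := measure_ne_top μ
      rw [← ENNReal.toReal_le_toReal (ENNReal.add_ne_top.2 ⟨hfin _, hfin _⟩)
        (ENNReal.add_ne_top.2 ⟨hfin _, hfin _⟩), ENNReal.toReal_add (hfin _) (hfin _),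
        ENNReal.toReal_add (hfin _) (hfin _)]
      exact h3
    rw [h0, add_zero] at h1
    have h5 : μ (X ∪ Y) ≤ μ Q := measure_mono h2
    rw [h1] at h5
    exact absurd (h4.trans h5) (not_le.2 hlt)

/-- **Kemperman's theorem**: if `1 ∈ A ∩ B` and `AB` lies in a set `Q` of measure less than
`m(A) + m(B)`, then `Q` contains an open subgroup. -/
theorem exists_isOpen_subgroup_subset {A B Q : Set G} (hA : MeasurableSet A)
    (hB : MeasurableSet B) (h1A : (1 : G) ∈ A) (h1B : (1 : G) ∈ B)
    (hQ : ∀ x ∈ A, ∀ y ∈ B, x * y ∈ Q) (hlt : haarProb G Q < haarProb G A + haarProb G B) :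
    ∃ H : Subgroup G, IsOpen (H : Set G) ∧ (H : Set G) ⊆ Q := by
  obtain ⟨X, Y, hX, hY, hXY, hstab, hpos⟩ :=
    exists_pair_inter_subset_aestabilizer hA hB h1A h1B hQ hlt
  set H := MulAction.aestabilizer G (haarProb G) Y
  have hopen : IsOpen (H : Set G) := by
    -- Steinhaus: the quotients of a set of positive measure form a neighbourhood of `1`.
    refine H.isOpen_of_mem_nhds (g := 1) (mem_of_superset
      (Measure.div_mem_nhds_one_of_haar_pos (haarProb G) (X ∩ Y) (hX.inter hY)
        (pos_iff_ne_zero.2 hpos)) ?_)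
    rintro _ ⟨x, hx, y, hy, rfl⟩
    exact H.div_mem (hstab hx) (hstab hy)
  have hnull : haarProb G ((H : Set G) \ Y) = 0 := by
    refine measure_subgroup_diff_eq_zero hopen hY le_rfl fun h0 => hpos (measure_mono_null ?_ h0)
    exact fun x hx => ⟨hstab hx, hx.2⟩
  refine ⟨H, hopen, fun x hx => ?_⟩
  by_contra hxQ
  -- If `x ∉ Q`, then `Z = (X ∩ Y)⁻¹x` lies in `H` and misses `Y`, so it is null, yet it has the
  -- measure of `X ∩ Y`.
  set Z : Set G := (fun z => x * z⁻¹) ⁻¹' (X ∩ Y)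
  have hZH : Z ⊆ (H : Set G) \ Y := by
    intro z hz
    have h1 := hstab hz
    refine ⟨?_, fun hzY => hxQ ?_⟩
    · have := H.mul_mem (H.inv_mem h1) hx
      simpa using this
    · simpa using hXY _ hz.1 z hzY
  apply hpos
  have h1 : haarProb G Z = haarProb G (X ∩ Y) := by
    have : Z = (((x * ·) ⁻¹' (X ∩ Y)) : Set G)⁻¹ := rfl
    rw [this, Measure.measure_inv, measure_preimage_mul]
  rw [← h1]
  exact measure_mono_null hZH hnull

end Kemperman


/-! ### Pairs that agree up to null sets -/

section Stability

variable {G : Type u} [Group G] [TopologicalSpace G] [IsTopologicalGroup G] [CompactSpace G]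
  [MeasurableSpace G] [BorelSpace G]

/-- **Kemperman's theorem** around a point `ab` of `AB`. -/
theorem exists_isOpen_subgroup_mul_mem {A B Q : Set G} (hA : MeasurableSet A)
    (hB : MeasurableSet B) {a b : G} (ha : a ∈ A) (hb : b ∈ B)
    (hQ : ∀ x ∈ A, ∀ y ∈ B, x * y ∈ Q) (hlt : haarProb G Q < haarProb G A + haarProb G B) :
    ∃ H : Subgroup G, IsOpen (H : Set G) ∧ ∀ h ∈ H, a * h * b ∈ Q := by
  have hm : ∀ s : Set G, haarProb G ((a * ·) ⁻¹' s) = haarProb G s := measure_preimage_mul _ a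
  have hm' : ∀ s : Set G, haarProb G ((· * b) ⁻¹' s) = haarProb G s :=
    measure_preimage_mul_right _ b
  refine exists_isOpen_subgroup_subset (A := (a * ·) ⁻¹' A) (B := (· * b) ⁻¹' B)
    (Q := (a * ·) ⁻¹' ((· * b) ⁻¹' Q)) (measurable_const_mul a hA) (measurable_mul_const b hB)
    (by simpa using ha) (by simpa using hb) (fun x hx y hy => ?_) ?_
  · simpa [mul_assoc] using hQ _ hx _ hy
  · rwa [hm, hm, hm', hm']

/-- Kemperman's theorem for `Q ∪ {a * b}`, whose extra point costs no measure. -/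
theorem exists_nhds_measure_diff_eq_zero {A B Q : Set G} (hA : MeasurableSet A)
    (hB : MeasurableSet B) {a b : G} (ha : a ∈ A) (hb : b ∈ B)
    (hQ : ∀ x ∈ A, ∀ y ∈ B, x * y ∈ Q ∪ {a * b}) (h0 : haarProb G {a * b} = 0)
    (hlt : haarProb G Q < haarProb G A + haarProb G B) :
    ∃ V ∈ 𝓝 (a * b), haarProb G (V \ Q) = 0 := by
  have hlt' : haarProb G (Q ∪ {a * b}) < haarProb G A + haarProb G B :=
    (measure_union_le _ _).trans_lt (by rwa [h0, add_zero])
  obtain ⟨H, hH, hsub⟩ := exists_isOpen_subgroup_mul_mem hA hB ha hb hQ hlt'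
  refine ⟨(fun x => a⁻¹ * x * b⁻¹) ⁻¹' H, ?_, measure_mono_null ?_ h0⟩
  · refine (hH.preimage (by fun_prop)).mem_nhds ?_
    simp [mul_assoc, H.one_mem]
  · rintro x ⟨hx, hxQ⟩
    have := hsub _ hx
    have h1 : a * (a⁻¹ * x * b⁻¹) * b = x := by group
    rw [h1] at this
    exact this.resolve_left hxQ

theorem isOpen_mul_of_measure_lt {A B : Set G} (hA : MeasurableSet A) (hB : MeasurableSet B)
    (hlt : haarProb G (A * B) < haarProb G A + haarProb G B) : IsOpen (A * B) := by
  rw [isOpen_iff_mem_nhds]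
  rintro _ ⟨a, ha, b, hb, rfl⟩
  obtain ⟨H, hH, hsub⟩ := exists_isOpen_subgroup_mul_mem hA hB ha hb
    (fun x hx y hy => mul_mem_mul hx hy) hlt
  refine mem_of_superset ((hH.preimage (f := fun x => a⁻¹ * x * b⁻¹) (by fun_prop)).mem_nhds ?_)
    fun x hx => ?_
  · simp [mul_assoc, H.one_mem]
  · have := hsub _ hx
    have h1 : a * (a⁻¹ * x * b⁻¹) * b = x := by group
    rwa [h1] at this

/-- The preimages `f y ⁻¹' Q` vary continuously in measure with `y`, so the condition on `y` is
closed. -/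
theorem measure_diff_preimage_eq_zero_of_mem_closure [T2Space G] {f : G → C(G, G)}
    (hf : Continuous f) (hfm : ∀ z, MeasurePreserving (f z) (haarProb G) (haarProb G))
    {X Q : Set G} (hQ : MeasurableSet Q) {S : Set G}
    (hS : ∀ y ∈ S, haarProb G (X \ f y ⁻¹' Q) = 0) {b : G} (hb : b ∈ closure S) :
    haarProb G (X \ f b ⁻¹' Q) = 0 := by
  have ht := tendsto_measure_symmDiff_preimage_nhds_zero (hf.tendsto b) (.of_forall hfm) (hfm b)
    hQ.nullMeasurableSet (measure_ne_top _ Q)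
  rw [← nonpos_iff_eq_zero]
  have : NeBot (𝓝[S] b) := mem_closure_iff_nhdsWithin_neBot.1 hb
  refine ge_of_tendsto (ht.mono_left (nhdsWithin_le_nhds (s := S))) ?_
  filter_upwards [self_mem_nhdsWithin] with y hy
  refine (measure_mono (t := (X \ f y ⁻¹' Q) ∪ symmDiff (f y ⁻¹' Q) (f b ⁻¹' Q)) ?_).trans
    ((measure_union_le _ _).trans (by rw [hS y hy, zero_add]))
  rintro x ⟨hx, hxb⟩
  by_cases hxy : x ∈ f y ⁻¹' Q
  · exact Or.inr (Or.inl ⟨hxy, hxb⟩)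
  · exact Or.inl ⟨hx, hxy⟩

theorem IsRegularSet.measure_inter_ne_zero {A U : Set G} (hA : IsRegularSet A) (hU : IsOpen U)
    (h : (A ∩ U).Nonempty) : haarProb G (A ∩ U) ≠ 0 := by
  obtain ⟨x, hx, hxU⟩ := h
  rw [hA] at hx
  obtain ⟨y, hyU, hy⟩ := mem_closure_iff.1 hx U hU hxU
  have hpos := ((isOpen_interior.inter hU).measure_pos (haarProb G) ⟨y, hy, hyU⟩).ne'
  exact fun h0 => hpos (measure_mono_null (inter_subset_inter_left _ interior_subset) h0)

theorem IsRegularSet.isClosed {X : Type u} [TopologicalSpace X] {A : Set X}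
    (hA : IsRegularSet A) : IsClosed A := by
  rw [hA]; exact isClosed_closure

theorem IsRegularSet.subset_closure_of_measure_diff {A A₀ : Set G} (hA : IsRegularSet A)
    (h : haarProb G (A \ A₀) = 0) : A ⊆ closure A₀ := by
  intro x hx
  by_contra hx'
  refine hA.measure_inter_ne_zero isClosed_closure.isOpen_compl ⟨x, hx, hx'⟩
    (measure_mono_null ?_ h)
  exact inter_subset_inter_right _ (compl_subset_compl.2 subset_closure)

theorem measure_le_of_diff_null {X : Type*} [MeasurableSpace X] {μ : Measure X} {A A₀ P : Set X}
    (h : μ (A \ A₀) = 0) (h' : μ (A \ P) = 0) : μ A ≤ μ (A₀ ∩ P) := by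
  refine (measure_mono (t := (A₀ ∩ P) ∪ ((A \ A₀) ∪ (A \ P))) fun x hx => ?_).trans
    ((measure_union_le _ _).trans ?_)
  · by_cases h1 : x ∈ A₀ <;> by_cases h2 : x ∈ P <;> simp [hx, h1, h2]
  · rw [measure_union_null h h', add_zero]

/-- Removing null sets from regular sets `A` and `B` can reduce the measure of `AB` only to a value
that is at least `m(A) + m(B)`. -/
theorem measure_mul_le_of_isRegularSet [T2Space G] {A B A₀ B₀ : Set G} (hA : IsRegularSet A)
    (hB : IsRegularSet B) (hmA₀ : MeasurableSet A₀) (hmB₀ : MeasurableSet B₀)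
    (hA₀ : A₀ ⊆ A) (hB₀ : B₀ ⊆ B) (hnA : haarProb G (A \ A₀) = 0) (hnB : haarProb G (B \ B₀) = 0)
    (hlt : haarProb G (A₀ * B₀) < haarProb G A + haarProb G B) :
    haarProb G (A * B) ≤ haarProb G (A₀ * B₀) := by
  have hmA : haarProb G A₀ = haarProb G A :=
    measure_eq_measure_of_null_sdiff hA₀ hnA
  have hmB : haarProb G B₀ = haarProb G B :=
    measure_eq_measure_of_null_sdiff hB₀ hnB
  have hopen : IsOpen (A₀ * B₀) := isOpen_mul_of_measure_lt hmA₀ hmB₀ (by rwa [hmA, hmB])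
  set Q := A₀ * B₀
  by_cases hatom : haarProb G ({1} : Set G) = 0
  · have hsing : ∀ x : G, haarProb G {x} = 0 := fun x => by
      rw [← hatom, ← measure_preimage_mul (haarProb G) x {x}]
      congr 1
      ext y; simp
    -- For `b ∈ B₀` this is clear, and `B₀` is dense in `B` by regularity.
    have hright : ∀ b ∈ B, haarProb G (A \ (· * b) ⁻¹' Q) = 0 := by
      intro b hb
      refine measure_diff_preimage_eq_zero_of_mem_closure
        (f := fun y => ⟨(· * y), continuous_mul_const y⟩)
        (ContinuousMap.continuous_of_continuous_uncurry _ (continuous_snd.mul continuous_fst))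
        (fun y => measurePreserving_mul_right _ y) hopen.measurableSet (S := B₀) ?_
        (hB.subset_closure_of_measure_diff hnB hb)
      refine fun y hy => measure_mono_null (t := A \ A₀) (fun x hx => ⟨hx.1, fun hx' => hx.2 ?_⟩) hnA
      exact mul_mem_mul hx' hy
    have hleft : ∀ a ∈ A, haarProb G (B \ (a * ·) ⁻¹' Q) = 0 := by
      intro a ha
      refine measure_diff_preimage_eq_zero_of_mem_closure
        (f := fun y => ⟨(y * ·), continuous_const_mul y⟩)
        (ContinuousMap.continuous_of_continuous_uncurry _ (continuous_fst.mul continuous_snd))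
        (fun y => measurePreserving_mul_left _ y) hopen.measurableSet (S := A₀) ?_
        (hA.subset_closure_of_measure_diff hnA ha)
      refine fun y hy => measure_mono_null (t := B \ B₀) (fun x hx => ⟨hx.1, fun hx' => hx.2 ?_⟩) hnB
      exact mul_mem_mul hy hx'
    have hcomp : IsCompact ((A * B) \ Q) :=
      (hA.isClosed.isCompact.mul hB.isClosed.isCompact).diff hopen
    have hnull : haarProb G ((A * B) \ Q) = 0 := by
      refine hcomp.measure_zero_of_nhdsWithin ?_
      rintro _ ⟨⟨a, ha, b, hb, rfl⟩, -⟩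
      -- The cuts by translates of `Q` remove only null sets. They ensure that adjoining `a` and `b`
      -- adds at most the single point `a * b` to the products outside `Q`.
      obtain ⟨V, hV, hV0⟩ := exists_nhds_measure_diff_eq_zero
        (A := A₀ ∩ (· * b) ⁻¹' Q ∪ {a}) (B := B₀ ∩ (a * ·) ⁻¹' Q ∪ {b}) (Q := Q) (a := a) (b := b)
        ((hmA₀.inter (measurable_mul_const b hopen.measurableSet)).union (measurableSet_singleton a))
        ((hmB₀.inter (measurable_const_mul a hopen.measurableSet)).union (measurableSet_singleton b))
        (Or.inr rfl) (Or.inr rfl)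
        (by
          rintro x (⟨hx, hx'⟩ | rfl) y (⟨hy, hy'⟩ | rfl)
          · exact Or.inl (mul_mem_mul hx hy)
          · exact Or.inl hx'
          · exact Or.inl hy'
          · exact Or.inr rfl)
        (hsing _)
        (hlt.trans_le (add_le_add
          ((measure_le_of_diff_null hnA (hright b hb)).trans (measure_mono subset_union_left))
          ((measure_le_of_diff_null hnB (hleft a ha)).trans (measure_mono subset_union_left))))
      refine ⟨V \ Q, ?_, hV0⟩
      filter_upwards [self_mem_nhdsWithin, mem_nhdsWithin_of_mem_nhds hV] with x hx hxV
      exact ⟨hxV, hx.2⟩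
    exact (measure_le_inter_add_sdiff _ _ Q).trans
      (by rw [hnull, add_zero]; exact measure_mono inter_subset_right)
  -- If points have positive measure, null sets are empty and nothing was removed.
  · have hempty : ∀ s : Set G, haarProb G s = 0 → s = ∅ := by
      intro s hs
      by_contra hne
      obtain ⟨x, hx⟩ := nonempty_iff_ne_empty.2 hne
      apply hatom
      rw [← measure_preimage_mul (haarProb G) x⁻¹ {1}]
      refine measure_mono_null (fun y hy => ?_) hs
      have : y = x := (inv_mul_eq_one.1 hy).symm
      rwa [this]
    have h1 : A ⊆ A₀ := sdiff_eq_empty.1 (hempty _ hnA)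
    have h2 : B ⊆ B₀ := sdiff_eq_empty.1 (hempty _ hnB)
    exact measure_mono (mul_subset_mul h1 h2)

theorem IsStablePair.eq_univ_of_mul_eq_univ {G : Type u} [Group G] {A B : Set G}
    (h : IsStablePair A B) (hAB : A * B = univ) : A = univ ∧ B = univ :=
  ⟨eq_univ_of_forall fun x => h.1 x (hAB ▸ subset_univ _),
    eq_univ_of_forall fun y => h.2 y (hAB ▸ subset_univ _)⟩

theorem IsStablePair.subset_of_measure_diff_eq_zero [T2Space G] {A₁ B₁ A₂ B₂ : Set G}
    (hst : IsStablePair A₂ B₂) (hA₂ : IsRegularSet A₂) (hB₂ : IsRegularSet B₂)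
    (hA : A₁ =ᵐ[haarProb G] A₂) (hB : B₁ =ᵐ[haarProb G] B₂)
    (h : haarProb G ((A₁ * B₁) \ (A₂ * B₂)) = 0) : A₁ ⊆ A₂ ∧ B₁ ⊆ B₂ := by
  have hopen : IsOpen (A₂ * B₂)ᶜ :=
    (hA₂.isClosed.isCompact.mul hB₂.isClosed.isCompact).isClosed.isOpen_compl
  constructor
  · refine fun a ha => hst.1 a ?_
    rw [singleton_mul, image_subset_iff]
    intro b hb
    by_contra hab
    refine hB₂.measure_inter_ne_zero (hopen.preimage (continuous_const_mul a)) ⟨b, hb, hab⟩ ?_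
    refine (measure_congr (t := B₁ ∩ _) (hB.symm.inter (ae_eq_refl _))).trans ?_
    rw [← h,
      ← measure_preimage_mul (haarProb G) a ((A₁ * B₁) \ (A₂ * B₂))]
    refine le_antisymm (measure_mono fun x hx => ⟨mul_mem_mul ha hx.1, hx.2⟩) ?_
    rw [measure_preimage_mul, h]
    exact zero_le
  · refine fun b hb => hst.2 b ?_
    rw [mul_singleton, image_subset_iff]
    intro a ha
    by_contra hab
    refine hA₂.measure_inter_ne_zero (hopen.preimage (continuous_mul_const b)) ⟨a, ha, hab⟩ ?_
    refine (measure_congr (t := A₁ ∩ _) (hA.symm.inter (ae_eq_refl _))).trans ?_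
    rw [← h,
      ← measure_preimage_mul_right (haarProb G) b ((A₁ * B₁) \ (A₂ * B₂))]
    refine le_antisymm (measure_mono fun x hx => ⟨mul_mem_mul hx.1 hb, hx.2⟩) ?_
    rw [measure_preimage_mul_right, h]
    exact zero_le

theorem mul_eq_univ_of_measure_eq_one [T2Space G] {A B : Set G} (hA : IsRegularSet A)
    (hB : IsRegularSet B) (h : haarProb G (A * B) = 1) : A * B = univ := by
  have hcl : IsClosed (A * B) := (hA.isClosed.isCompact.mul hB.isClosed.isCompact).isClosed
  have h0 : haarProb G (A * B)ᶜ = 0 := (prob_compl_eq_zero_iff hcl.measurableSet).2 h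
  exact compl_empty_iff.1 ((hcl.isOpen_compl.measure_eq_zero_iff _).1 h0)

/-- A stable pair of regular sets contains every pair that agrees with it up to null sets and whose
product set is not larger. -/
theorem subset_of_ae_eq_of_isStablePair [T2Space G] {A₁ B₁ A₂ B₂ : Set G}
    (hmA : MeasurableSet A₁) (hmB : MeasurableSet B₁) (hcrit : IsCriticalPair A₂ B₂)
    (hle : haarProb G (A₁ * B₁) ≤ haarProb G (A₂ * B₂))
    (hA : A₁ =ᵐ[haarProb G] A₂) (hB : B₁ =ᵐ[haarProb G] B₂)
    (hst : IsStablePair A₂ B₂) (hA₂ : IsRegularSet A₂) (hB₂ : IsRegularSet B₂) :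
    A₁ ⊆ A₂ ∧ B₁ ⊆ B₂ := by
  by_cases h1 : haarProb G (A₂ * B₂) = 1
  · obtain ⟨hA', hB'⟩ := hst.eq_univ_of_mul_eq_univ (mul_eq_univ_of_measure_eq_one hA₂ hB₂ h1)
    simp [hA', hB']
  have hsum : haarProb G (A₂ * B₂) = haarProb G A₂ + haarProb G B₂ := by
    have h := hcrit.measure_mul
    rcases min_choice 1 (haarProb G A₂ + haarProb G B₂) with h' | h' <;> rw [h'] at h
    · exact absurd h h1
    · exact h
  -- If the smaller product has measure at least `m(A₂) + m(B₂)`, criticality already gives the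
  -- bound.
  have hm : haarProb G (A₂ * B₂) ≤ haarProb G ((A₁ ∩ A₂) * (B₁ ∩ B₂)) := by
    by_cases hlt : haarProb G ((A₁ ∩ A₂) * (B₁ ∩ B₂)) < haarProb G A₂ + haarProb G B₂
    · refine measure_mul_le_of_isRegularSet hA₂ hB₂ (hmA.inter hA₂.isClosed.measurableSet)
        (hmB.inter hB₂.isClosed.measurableSet) inter_subset_right inter_subset_right ?_ ?_ hlt
      · rw [sdiff_inter_self_eq_sdiff]
        exact (ae_le_set.1 hA.symm.le)
      · rw [sdiff_inter_self_eq_sdiff]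
        exact (ae_le_set.1 hB.symm.le)
    · rw [hsum]; exact not_lt.1 hlt
  refine hst.subset_of_measure_diff_eq_zero hA₂ hB₂ hA hB ?_
  have hcl : MeasurableSet (A₂ * B₂) :=
    (hA₂.isClosed.isCompact.mul hB₂.isClosed.isCompact).isClosed.measurableSet
  have hsplit := measure_inter_add_sdiff (μ := haarProb G) (A₁ * B₁) hcl
  have hinter : haarProb G ((A₁ ∩ A₂) * (B₁ ∩ B₂)) ≤ haarProb G ((A₁ * B₁) ∩ (A₂ * B₂)) :=
    measure_mono (subset_inter (mul_subset_mul inter_subset_left inter_subset_left)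
      (mul_subset_mul inter_subset_right inter_subset_right))
  have hle' : haarProb G ((A₁ * B₁) ∩ (A₂ * B₂)) + haarProb G ((A₁ * B₁) \ (A₂ * B₂)) ≤
      haarProb G ((A₁ * B₁) ∩ (A₂ * B₂)) + 0 := by
    rw [hsplit, add_zero]
    exact hle.trans (hm.trans hinter)
  exact nonpos_iff_eq_zero.1 ((ENNReal.add_le_add_iff_left (measure_ne_top _ _)).1 hle')

end Stability


/-! ### Measures and regularity under preimages -/

/-- Always `γ = l(a + b) ≤ l(i + j) = ld ≤ d`, so either alternative for `γ` forces `γ = ld` and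
equality throughout. In the application `l = m(L)`, `d = m(IJ)`, `γ = m(AB)`; `a`, `b`, `c` are the
measures in `S` of the two sources and of the product of their translates. -/
theorem ENNReal.eq_of_critical_measures {a b i j l c d γ : ℝ≥0∞} (ha : a ≤ i) (hb : b ≤ j)
    (hl : l ≤ 1) (hl0 : l ≠ 0) (hd : d = min 1 (i + j)) (hd1 : d ≠ 1)
    (hγ : γ = min 1 (a * l + b * l)) (hc : c * l ≤ γ) (h : γ = d ∨ γ = l * d) :
    a = i ∧ b = j ∧ c ≤ d := by
  have hlt : l ≠ ∞ := ne_top_of_le_ne_top one_ne_top hl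
  have hdlt : d < 1 := lt_of_le_of_ne (hd ▸ min_le_left _ _) hd1
  have hd' : d = i + j := by
    rcases min_choice 1 (i + j) with h' | h' <;> rw [h'] at hd
    · exact absurd hd hd1
    · exact hd
  have hld : l * d ≤ d := mul_le_of_le_one_left' hl
  have hγ1 : γ < 1 := by
    rcases h with h | h <;> rw [h]
    · exact hdlt
    · exact hld.trans_lt hdlt
  have hγ' : γ = l * (a + b) := by
    rcases min_choice 1 (a * l + b * l) with h' | h' <;> rw [h'] at hγ
    · exact absurd hγ hγ1.ne
    · rw [hγ]; ring
  have hab : a + b ≤ d := hd' ▸ add_le_add ha hb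
  have hγd : γ = l * d := by
    rcases h with h | h
    · refine le_antisymm (hγ' ▸ mul_le_mul_right hab l) (hld.trans h.ge)
    · exact h
  have hdt : d ≠ ∞ := hdlt.ne_top
  have hsum : a + b = i + j := by
    rw [hγd, ENNReal.mul_right_inj hl0 hlt] at hγ'
    rw [← hγ', hd']
  have hit : i ≠ ∞ := ne_top_of_le_ne_top hdt (hd' ▸ le_self_add)
  have hjt : j ≠ ∞ := ne_top_of_le_ne_top hdt (hd' ▸ le_add_self)
  refine ⟨le_antisymm ha ?_, le_antisymm hb ?_, ?_⟩
  · refine (ENNReal.add_le_add_iff_right hjt).1 ?_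
    rw [← hsum]
    exact add_le_add le_rfl hb
  · refine (ENNReal.add_le_add_iff_left hit).1 ?_
    rw [← hsum]
    exact add_le_add ha le_rfl
  · rw [hγd, mul_comm] at hc
    exact (ENNReal.mul_le_mul_iff_right hl0 hlt).1 hc

theorem IsOpenMap.isRegularSet_preimage {X Y : Type*} [TopologicalSpace X] [TopologicalSpace Y]
    {f : X → Y} (hf : IsOpenMap f) (hc : Continuous f) {A : Set Y} (hA : IsRegularSet A) :
    IsRegularSet (f ⁻¹' A) := by
  rw [IsRegularSet, ← hf.preimage_interior_eq_interior_preimage hc,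
    ← hf.preimage_closure_eq_closure_preimage hc, ← hA]

/-- The measure of the preimage of a set under a continuous homomorphism onto an open subgroup. -/
theorem measure_preimage_subgroup_mul {G : Type u} [Group G] [TopologicalSpace G]
    [IsTopologicalGroup G] [CompactSpace G] [MeasurableSpace G] [BorelSpace G]
    {S : Type w} [Group S] [TopologicalSpace S] [IsTopologicalGroup S] [CompactSpace S]
    [MeasurableSpace S] [BorelSpace S] {L : Subgroup G} (hL : IsOpen (L : Set G)) {p : S →* L}
    (hp : Continuous p) (hps : Function.Surjective p) {F : Set G} (hF : MeasurableSet F) :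
    haarProb S {x | (p x : G) ∈ F} * haarProb G L = haarProb G (F ∩ L) := by
  have hcl : IsClosed (L : Set G) := L.isClosed_of_isOpen hL
  have : CompactSpace L := isCompact_iff_compactSpace.1 hcl.isCompact
  have hemb : IsOpenEmbedding L.subtype := hL.isOpenEmbedding_subtypeVal
  have hme : MeasurableEmbedding L.subtype := hemb.measurableEmbedding
  have : ((haarProb G).comap L.subtype).IsHaarMeasure :=
    @Measure.IsHaarMeasure.comap _ _ _ _ _ _ _ _ _ _ _ inferInstance (haarProb G) _ L.subtype hemb
  have hval : ∀ X : Set L, (haarProb G).comap L.subtype X = haarProb G (L.subtype '' X) :=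
    fun X => hme.comap_apply _ X
  have h1 := eq_measure_univ_mul_haarProb ((haarProb G).comap L.subtype) (L.subtype ⁻¹' F)
  have h2 : haarProb S (p ⁻¹' (L.subtype ⁻¹' F)) = haarProb L (L.subtype ⁻¹' F) :=
    (p.measurePreserving hp hps (by simp)).measure_preimage (hme.measurable hF).nullMeasurableSet
  rw [hval, hval, image_univ, image_preimage_eq_inter_range, ← h2, mul_comm] at h1
  simp only [Subgroup.coe_subtype, Subtype.range_coe_subtype] at h1
  exact h1.symm

theorem measure_preimage_subgroup_mul_le {G : Type u} [Group G] [TopologicalSpace G]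
    [IsTopologicalGroup G] [CompactSpace G] [MeasurableSpace G] [BorelSpace G]
    {S : Type w} [Group S] [TopologicalSpace S] [IsTopologicalGroup S] [CompactSpace S]
    [MeasurableSpace S] [BorelSpace S] {L : Subgroup G} (hL : IsOpen (L : Set G)) {p : S →* L}
    (hp : Continuous p) (hps : Function.Surjective p) (F : Set G) :
    haarProb S {x | (p x : G) ∈ F} * haarProb G L ≤ haarProb G F := by
  rw [← measure_toMeasurable F]
  refine le_trans ?_ (measure_mono (inter_subset_left (t := (L : Set G))))
  rw [← measure_preimage_subgroup_mul hL hp hps (measurableSet_toMeasurable _ F)]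
  gcongr
  exact subset_toMeasurable _ F

/-! ### Transfer to the covering group `S` through the coordinate in `M` -/

namespace ReductionData

variable {G : Type u} {M : Type v} [Group G] [TopologicalSpace G] [Group M] [TopologicalSpace M]

/-- The component of `π` in `M`. -/
def leftCoord (D : ReductionData.{u, v, w} G M) (x : D.S) : M := (D.π x).left

variable (D : ReductionData.{u, v, w} G M)

theorem continuous_leftCoord : Continuous D.leftCoord :=
  (continuous_induced_rng.1 D.continuous_π).fst

theorem leftCoord_mul (x y : D.S) :
    D.leftCoord (x * y) = D.leftCoord x * (D.π x).right.1 (D.leftCoord y) := by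
  simp [leftCoord]

theorem exists_leftCoord_mul (m : M) :
    ∃ x : D.S, D.π x = ⟨m, 1⟩ ∧ ∀ y, D.leftCoord (x * y) = m * D.leftCoord y := by
  obtain ⟨x, hx⟩ := D.surjective_π ⟨m, 1⟩
  refine ⟨x, hx, fun y => ?_⟩
  rw [leftCoord_mul, leftCoord, hx]
  rfl

theorem surjective_leftCoord : Function.Surjective D.leftCoord := fun m => by
  obtain ⟨x, hx, -⟩ := D.exists_leftCoord_mul m
  exact ⟨x, by rw [leftCoord, hx]⟩

variable {A B : Set G} {I J : Set M}

theorem preimage_leftCoord_mul (hJ : ∀ k ∈ D.K, (fun x : M => k x) '' J = J) :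
    D.leftCoord ⁻¹' I * D.leftCoord ⁻¹' J = D.leftCoord ⁻¹' (I * J) := by
  ext x
  constructor
  · rintro ⟨y, hy, z, hz, rfl⟩
    change D.leftCoord (y * z) ∈ I * J
    rw [leftCoord_mul]
    refine mul_mem_mul hy ?_
    rw [← hJ _ (D.π y).right.2]
    exact mem_image_of_mem _ hz
  · rintro ⟨i, hi, j, hj, hij⟩
    obtain ⟨y, hy, hmul⟩ := D.exists_leftCoord_mul i
    refine ⟨y, ?_, y⁻¹ * x, ?_, mul_inv_cancel_left _ _⟩
    · change (D.π y).left ∈ I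
      rwa [hy]
    · have h1 := hmul (y⁻¹ * x)
      rw [mul_inv_cancel_left, ← hij] at h1
      change D.leftCoord (y⁻¹ * x) ∈ J
      rwa [← mul_left_cancel h1]

/-- The twist by `K` in the product law is absorbed by the invariance of `J`; on the other side each
`i ∈ I` is lifted to an element with trivial `K`-component. -/
theorem isStablePair_preimage_leftCoord (hJ : ∀ k ∈ D.K, (fun x : M => k x) '' J = J)
    (h : IsStablePair I J) : IsStablePair (D.leftCoord ⁻¹' I) (D.leftCoord ⁻¹' J) := by
  rw [IsStablePair, IsLeftStable, IsRightStable, D.preimage_leftCoord_mul hJ]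
  constructor
  · intro x hx
    refine h.1 _ ?_
    rw [singleton_mul, image_subset_iff] at hx ⊢
    intro j hj
    rw [← hJ _ (D.π x).right.2] at hj
    obtain ⟨j', hj', rfl⟩ := hj
    obtain ⟨y, rfl⟩ := D.surjective_leftCoord j'
    have := hx hj'
    rw [mem_preimage, mem_preimage, leftCoord_mul] at this
    exact this
  · intro y hy
    refine h.2 _ ?_
    rw [mul_singleton, image_subset_iff] at hy ⊢
    intro i hi
    obtain ⟨x, hx, hmul⟩ := D.exists_leftCoord_mul i
    have hxI : x ∈ D.leftCoord ⁻¹' I := by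
      change (D.π x).left ∈ I
      rwa [hx]
    have := hy hxI
    rw [mem_preimage, mem_preimage, hmul] at this
    exact this

theorem preimage_mul_left_leftTarget {y : D.S} (hy : D.π y = D.s') :
    (y * ·) ⁻¹' D.leftTarget I = D.leftCoord ⁻¹' I := by
  ext x
  simp [leftTarget, singleton_mul, hy, semidirectSet, leftCoord]

theorem preimage_mul_right_rightTarget {z : D.S} (hz : D.π z = D.t') :
    (· * z) ⁻¹' D.rightTarget J = D.leftCoord ⁻¹' J := by
  ext x
  simp [rightTarget, mul_singleton, hz, semidirectSet, leftCoord]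

theorem isOpenMap_leftCoord [T2Space M] : IsOpenMap D.leftCoord := by
  intro U hU
  have hq : IsQuotientMap D.leftCoord :=
    D.continuous_leftCoord.isClosedMap.isQuotientMap D.continuous_leftCoord D.surjective_leftCoord
  rw [← hq.isOpen_preimage]
  -- The fibres are the left cosets of the elements with `M`-coordinate `1`, so the saturation of an
  -- open set is open.
  have h : D.leftCoord ⁻¹' (D.leftCoord '' U) = U * (D.leftCoord ⁻¹' {1}) := by
    ext x
    constructor
    · rintro ⟨u, hu, hux⟩
      refine ⟨u, hu, u⁻¹ * x, ?_, mul_inv_cancel_left _ _⟩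
      have h1 := D.leftCoord_mul u (u⁻¹ * x)
      rw [mul_inv_cancel_left, ← hux, left_eq_mul] at h1
      simpa using h1
    · rintro ⟨u, hu, y, hy, rfl⟩
      refine ⟨u, hu, ?_⟩
      have hy' : D.leftCoord y = 1 := hy
      change _ = D.leftCoord (u * y)
      rw [leftCoord_mul, hy', map_one, mul_one]
  rw [h]
  exact hU.mul_right

variable [IsTopologicalGroup M] [CompactSpace M] [MeasurableSpace M] [BorelSpace M]

/-- Left translation by `m` lifts to left translation by an element over `(m, 1)`, so the image
measure is invariant and uniqueness applies. -/
theorem measurePreserving_leftCoord :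
    MeasurePreserving D.leftCoord (haarProb D.S) (haarProb M) := by
  have hm : Measurable D.leftCoord := D.continuous_leftCoord.measurable
  refine ⟨hm, ?_⟩
  have : IsProbabilityMeasure ((haarProb D.S).map D.leftCoord) :=
    Measure.isProbabilityMeasure_map hm.aemeasurable
  have : ((haarProb D.S).map D.leftCoord).IsMulLeftInvariant := by
    refine ⟨fun m => ?_⟩
    obtain ⟨x, -, hx⟩ := D.exists_leftCoord_mul m
    rw [Measure.map_map (measurable_const_mul m) hm]
    conv_rhs => rw [← map_mul_left_eq_self (haarProb D.S) x]
    rw [Measure.map_map hm (measurable_const_mul x)]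
    congr 1
    ext y
    exact (hx y).symm
  exact eq_haarProb _

variable [IsTopologicalGroup G] [CompactSpace G] [MeasurableSpace G] [BorelSpace G]

/-- Containment up to null sets in a regular stable pair is containment. -/
theorem contains_of_almostContains [T2Space M] (hAB : IsCriticalPair A B) (hIJ : IsCriticalPair I J)
    (hst : IsStablePair I J) (hI : IsRegularSet I) (hJ : IsRegularSet J)
    (hm : haarProb G (A * B) = haarProb M (I * J) ∨
      haarProb G (A * B) = haarProb G (D.L : Set G) * haarProb M (I * J))
    (had : D.IsAdapted A B J) (hal : D.AlmostContains A B I J) : D.Contains A B I J := by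
  -- Translating by lifts of `s'` and `t'` turns the targets into preimages of `I` and `J` under
  -- `leftCoord`.
  obtain ⟨y, hy⟩ := D.surjective_π D.s'
  obtain ⟨z, hz⟩ := D.surjective_π D.t'
  suffices h : (y * ·) ⁻¹' D.leftSource A ⊆ D.leftCoord ⁻¹' I ∧
      (· * z) ⁻¹' D.rightSource B ⊆ D.leftCoord ⁻¹' J by
    rw [← D.preimage_mul_left_leftTarget hy, ← D.preimage_mul_right_rightTarget hz] at h
    constructor
    · intro x hx
      have := @h.1 (y⁻¹ * x) (by simpa using hx)
      simpa using this
    · intro x hx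
      have := @h.2 (x * z⁻¹) (by simpa using hx)
      simpa using this
  by_cases h1 : haarProb M (I * J) = 1
  · obtain ⟨hI', hJ'⟩ := hst.eq_univ_of_mul_eq_univ (mul_eq_univ_of_measure_eq_one hI hJ h1)
    simp [hI', hJ']
  have hmp := D.measurePreserving_leftCoord
  have hmI : haarProb D.S (D.leftCoord ⁻¹' I) = haarProb M I :=
    hmp.measure_preimage hIJ.measurableSet_left.nullMeasurableSet
  have hmJ : haarProb D.S (D.leftCoord ⁻¹' J) = haarProb M J :=
    hmp.measure_preimage hIJ.measurableSet_right.nullMeasurableSet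
  have hmIJ : haarProb D.S (D.leftCoord ⁻¹' I * D.leftCoord ⁻¹' J) = haarProb M (I * J) := by
    rw [D.preimage_leftCoord_mul had.fixes]
    exact hmp.measure_preimage
      (hI.isClosed.isCompact.mul hJ.isClosed.isCompact).isClosed.measurableSet.nullMeasurableSet
  have hp : Continuous fun x : D.S => (D.p x : G) := continuous_subtype_val.comp D.continuous_p
  have hsA : MeasurableSet ({D.s} * A) := by
    rw [singleton_mul, ← Homeomorph.coe_mulLeft]
    exact (Homeomorph.mulLeft D.s).measurableEmbedding.measurableSet_image.2
      hAB.measurableSet_left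
  have hBt : MeasurableSet (B * {D.t}) := by
    rw [mul_singleton, ← Homeomorph.coe_mulRight]
    exact (Homeomorph.mulRight D.t).measurableEmbedding.measurableSet_image.2
      hAB.measurableSet_right
  have hAS : MeasurableSet (D.leftSource A) := hp.measurable hsA
  have hBS : MeasurableSet (D.rightSource B) := hp.measurable hBt
  have hleft : ∀ X : Set G, haarProb G ({D.s} * X) = haarProb G X := fun X => by
    rw [← measure_preimage_mul (haarProb G) D.s]
    simp [singleton_mul]
  have hright : ∀ X : Set G, haarProb G (X * {D.t}) = haarProb G X := fun X => by
    rw [← measure_preimage_mul_right (haarProb G) D.t]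
    simp [mul_singleton]
  set A₁ : Set D.S := (y * ·) ⁻¹' D.leftSource A with hA₁
  set B₁ : Set D.S := (· * z) ⁻¹' D.rightSource B with hB₁
  have hmA₁ : MeasurableSet A₁ := measurable_const_mul y hAS
  have hmB₁ : MeasurableSet B₁ := measurable_mul_const z hBS
  have haA : haarProb D.S A₁ * haarProb G (D.L : Set G) = haarProb G A := by
    rw [hA₁, measure_preimage_mul]
    refine (measure_preimage_subgroup_mul D.isOpen_L D.continuous_p D.surjective_p hsA).trans ?_
    rw [inter_eq_left.2 had.left_subset, hleft]
  have haB : haarProb D.S B₁ * haarProb G (D.L : Set G) = haarProb G B := by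
    rw [hB₁, measure_preimage_mul_right]
    refine (measure_preimage_subgroup_mul D.isOpen_L D.continuous_p D.surjective_p hBt).trans ?_
    rw [inter_eq_left.2 had.right_subset, hright]
  -- The translate `y(A₁B₁)z` lies over `sABt`. Only outer measure is available here, as `A * B`
  -- need not be measurable.
  have haAB : haarProb D.S (A₁ * B₁) * haarProb G (D.L : Set G) ≤ haarProb G (A * B) := by
    have hle : haarProb D.S (A₁ * B₁) ≤
        haarProb D.S {x | (D.p x : G) ∈ {D.s} * (A * B) * {D.t}} := by
      rw [← measure_preimage_mul (haarProb D.S) y {x | (D.p x : G) ∈ {D.s} * (A * B) * {D.t}},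
        ← measure_preimage_mul_right (haarProb D.S) z
          ((y * ·) ⁻¹' {x | (D.p x : G) ∈ {D.s} * (A * B) * {D.t}})]
      refine measure_mono ?_
      rintro _ ⟨a, ha, b, hb, rfl⟩
      change (D.p (y * (a * b * z)) : G) ∈ {D.s} * (A * B) * {D.t}
      have h2 : y * (a * b * z) = (y * a) * (b * z) := by group
      rw [h2, map_mul, Subgroup.coe_mul, ← mul_assoc ({D.s} : Set G),
        mul_assoc (({D.s} : Set G) * A)]
      exact mul_mem_mul ha hb
    refine (mul_le_mul_left hle _).trans ?_
    refine (measure_preimage_subgroup_mul_le D.isOpen_L D.continuous_p D.surjective_p _).trans ?_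
    rw [hright, hleft]
  have hnA : haarProb D.S (A₁ \ D.leftCoord ⁻¹' I) = 0 := by
    rw [← D.preimage_mul_left_leftTarget hy, hA₁, ← preimage_sdiff, measure_preimage_mul]
    exact hal.1
  have hnB : haarProb D.S (B₁ \ D.leftCoord ⁻¹' J) = 0 := by
    rw [← D.preimage_mul_right_rightTarget hz, hB₁, ← preimage_sdiff, measure_preimage_mul_right]
    exact hal.2
  have hleA : A₁ ≤ᵐ[haarProb D.S] (D.leftCoord ⁻¹' I : Set D.S) := ae_le_set.2 hnA
  have hleB : B₁ ≤ᵐ[haarProb D.S] (D.leftCoord ⁻¹' J : Set D.S) := ae_le_set.2 hnB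
  obtain ⟨e1, e2, e3⟩ := ENNReal.eq_of_critical_measures
    (hmI ▸ measure_mono_ae hleA) (hmJ ▸ measure_mono_ae hleB) prob_le_one
    (D.isOpen_L.measure_pos (haarProb G) ⟨1, D.L.one_mem⟩).ne' hIJ.measure_mul h1
    (by rw [haA, haB]; exact hAB.measure_mul) haAB hm
  have hcrit : IsCriticalPair (D.leftCoord ⁻¹' I) (D.leftCoord ⁻¹' J) :=
    ⟨hmp.measurable hIJ.measurableSet_left, hmp.measurable hIJ.measurableSet_right, by
      rw [hmIJ, hmI, hmJ, hIJ.measure_mul]⟩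
  exact subset_of_ae_eq_of_isStablePair hmA₁ hmB₁ hcrit (hmIJ ▸ e3)
    (ae_eq_of_ae_subset_of_measure_ge hleA (hmI.trans e1.symm).le hmA₁.nullMeasurableSet
      (measure_ne_top _ _))
    (ae_eq_of_ae_subset_of_measure_ge hleB (hmJ.trans e2.symm).le hmB₁.nullMeasurableSet
      (measure_ne_top _ _))
    (D.isStablePair_preimage_leftCoord had.fixes hst)
    (D.isOpenMap_leftCoord.isRegularSet_preimage D.continuous_leftCoord hI)
    (D.isOpenMap_leftCoord.isRegularSet_preimage D.continuous_leftCoord hJ)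

end ReductionData

theorem mainTheorem5 :
    (∀ (G : Type u) [Group G] [TopologicalSpace G] [IsTopologicalGroup G] [CompactSpace G]
        [T2Space G] [MeasurableSpace G] [BorelSpace G] (A₁ B₁ A₂ B₂ : Set G),
      IsCriticalPair A₁ B₁ → IsCriticalPair A₂ B₂ →
      A₁ =ᵐ[haarProb G] A₂ → B₁ =ᵐ[haarProb G] B₂ →
      IsStablePair A₂ B₂ → IsRegularSet A₂ → IsRegularSet B₂ →
      A₁ ⊆ A₂ ∧ B₁ ⊆ B₂) ∧
    (∀ (G : Type u) [Group G] [TopologicalSpace G] [IsTopologicalGroup G] [CompactSpace G]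
        [T2Space G] [MeasurableSpace G] [BorelSpace G]
        (M : Type v) [Group M] [TopologicalSpace M] [IsTopologicalGroup M] [CompactSpace M]
        [T2Space M] [MeasurableSpace M] [BorelSpace M] (A B : Set G) (I J : Set M),
      IsCriticalPair A B → IsCriticalPair I J →
      IsStablePair I J → IsRegularSet I → IsRegularSet J →
      (AlmostReduces.{u, v, w} A B I J → Reduces.{u, v, w} A B I J) ∧
      (∀ D : ReductionData.{u, v, w} G M,
        (haarProb G (A * B) = haarProb M (I * J) ∨
          haarProb G (A * B) = haarProb G (D.L : Set G) * haarProb M (I * J)) →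
        D.IsAdapted A B J → D.AlmostContains A B I J → D.Contains A B I J)) := by
  refine ⟨?_, ?_⟩
  · intro G _ _ _ _ _ _ _ A₁ B₁ A₂ B₂ h₁ h₂ hA hB hst hA₂ hB₂
    refine subset_of_ae_eq_of_isStablePair h₁.measurableSet_left h₁.measurableSet_right h₂ ?_
      hA hB hst hA₂ hB₂
    rw [h₁.measure_mul, h₂.measure_mul, measure_congr hA, measure_congr hB]
  · intro G _ _ _ _ _ _ _ M _ _ _ _ _ _ _ A B I J hAB hIJ hst hI hJ
    refine ⟨?_, fun D hm had hal => D.contains_of_almostContains hAB hIJ hst hI hJ hm had hal⟩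
    rintro ⟨hm, D, had, hal⟩
    exact ⟨hm, D, had, D.contains_of_almostContains hAB hIJ hst hI hJ (Or.inl hm) had hal⟩
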